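/- A partition is a finite nonincreasing sequence of positive integers $\lambda=(\lambda_1,\dots,\lambda_r)$ (the empty sequence is allowed), drawn as its Young diagram. A partition $\mu=(\mu_1,\dots,\mu_s)$ is a subpartition of $\lambda$ if $s\le r$ and $\mu_i\le\lambda_i$ for all $1\le i\le s$. The hook length of a cell of a Young diagram is the number of cells of the diagram that are equal to it, to the right of it in the same row, or below it in the same column. For a set $A$ of positive integers, a partition is an $A$-core if no cell of its Young diagram has hook length in $A$, and $A$ is called UM if there is an $A$-core that contains every $A$-core as a subpartition. A triple $(a,b,c)$ is called UM if the set $\{a,b,c\}$ is UM. Let $S(a,b)=\{ma+nb : m,n\in\mathbb{Z}_{\ge 0}\}$. Corollary 1.4. If $a<b<c$ are pairwise relatively prime positive integers, then $(a,b,c)$ is UM if and only if $c\in S(a,b)$. -/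

import Mathlib

/-- The hook length of the cell `c` in a Young diagram `μ` (a cell is a pair of a row index and a
column index, both counted from `0`): the number of cells of `μ` that lie weakly to the right of
`c` in the row of `c`, or weakly below `c` in the column of `c`. -/
def YoungDiagram.hookLength (μ : YoungDiagram) (c : ℕ × ℕ) : ℕ :=
  (μ.cells.filter fun d => (d.1 = c.1 ∧ c.2 ≤ d.2) ∨ (d.2 = c.2 ∧ c.1 ≤ d.1)).card

/-- A partition, given by its Young diagram, is an `A`-core if no cell has its hook length
in `A`. -/
def YoungDiagram.IsCore (A : Set ℕ) (μ : YoungDiagram) : Prop :=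
  ∀ c ∈ μ.cells, μ.hookLength c ∉ A

/-- A set `A` of positive integers is UM if some `A`-core contains every `A`-core as a
subpartition. The order `≤` on Young diagrams is containment. -/
def IsUM (A : Set ℕ) : Prop :=
  ∃ κ : YoungDiagram, κ.IsCore A ∧ ∀ μ : YoungDiagram, μ.IsCore A → μ ≤ κ

/-- The numerical semigroup `S(A)` generated by `A`: all linear combinations of elements of `A`
with nonnegative integer coefficients (so `0` belongs to it). -/
def numericalSemigroup (A : Set ℕ) : AddSubmonoid ℕ :=
  AddSubmonoid.closure A

/-! Walk along the boundary of a diagram. The positions of its horizontal steps form, after a shift,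
a cofinite set `D ⊆ ℕ` containing `0`, and hook lengths are differences between vertical and
horizontal positions. So `A`-cores correspond to such `D` closed under adding elements of `A`. The
smallest such `D` is the semigroup `S` generated by `A`. Column `j` has as many cells as `D` has
gaps above its `j`-th element, which turns containment into inequalities between enumerations.

If `c ∈ S(a,b)`, the diagram of `S(a,b)` is also a core for `c`. It dominates every `D`: modulo `a`,
the sorted Apéry set of `D` has gaps at most `b`, and `0, b, 2b, …` is the extreme case
(`count_le_count_add_of_gap_le`).

Conversely, a largest core must come from `S` itself, since `S` has the most gaps. With `F` the
largest gap of `S`, the set of `y` such that `F - y ∉ S` also gives a core; comparing first rows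
forces it to equal `S`, so `S` is symmetric (`IsUM.symmetric`). But when `c ∉ S(a,b)`, playing the
minimal relations among `a`, `b`, `c` against each other shows that `S` is not symmetric
(`not_symmetric_closure_triple`). -/

namespace YoungDiagram

/-! ### Boundary paths and hook lengths. -/

/-- The position of the horizontal boundary step below column `j`, along the boundary path. -/
def colEdge (μ : YoungDiagram) (j : ℕ) : ℤ := j - μ.colLen j

/-- The position of the vertical boundary step at the end of row `i`, along the boundary path. -/
def rowEdge (μ : YoungDiagram) (i : ℕ) : ℤ := μ.rowLen i - i - 1

theorem lt_rowLen_iff_lt_colLen (μ : YoungDiagram) {i j : ℕ} :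
    j < μ.rowLen i ↔ i < μ.colLen j := by
  rw [← mem_iff_lt_rowLen, mem_iff_lt_colLen]

theorem mem_iff_colEdge_lt_rowEdge (μ : YoungDiagram) {i j : ℕ} :
    (i, j) ∈ μ ↔ μ.colEdge j < μ.rowEdge i := by
  have h := μ.lt_rowLen_iff_lt_colLen (i := i) (j := j)
  rw [mem_iff_lt_rowLen, colEdge, rowEdge]
  omega

theorem rowEdge_ne_colEdge (μ : YoungDiagram) (i j : ℕ) : μ.rowEdge i ≠ μ.colEdge j := by
  have h := μ.lt_rowLen_iff_lt_colLen (i := i) (j := j)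
  rw [colEdge, rowEdge]
  omega

theorem exists_rowEdge_or_exists_colEdge (μ : YoungDiagram) (n : ℤ) :
    (∃ i, μ.rowEdge i = n) ∨ ∃ j, μ.colEdge j = n := by
  classical
  have hex : ∃ i, μ.rowEdge i ≤ n := by
    refine ⟨μ.rowLen 0 + n.natAbs, ?_⟩
    have := μ.rowLen_anti 0 (μ.rowLen 0 + n.natAbs) (Nat.zero_le _)
    rw [rowEdge]
    omega
  obtain ⟨i, hi, hmin⟩ : ∃ i, μ.rowEdge i ≤ n ∧ ∀ k < i, ¬ μ.rowEdge k ≤ n :=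
    ⟨Nat.find hex, Nat.find_spec hex, fun k hk => Nat.find_min hex hk⟩
  rcases hi.eq_or_lt with h | h
  · exact Or.inl ⟨i, h⟩
  -- Row `i` stops at or before column `n + i` and row `i - 1`, if any, passes it, so that column
  -- has length `i`.
  refine Or.inr ⟨(n + i).toNat, ?_⟩
  rw [rowEdge] at h
  have h1 := μ.lt_rowLen_iff_lt_colLen (i := i) (j := (n + i).toNat)
  rw [colEdge]
  rcases i with _ | k
  · omega
  · have h2 := μ.lt_rowLen_iff_lt_colLen (i := k) (j := (n + (k + 1 : ℕ)).toNat)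
    have h3 := hmin k (Nat.lt_succ_self k)
    rw [rowEdge] at h3
    omega

theorem hookLength_eq (μ : YoungDiagram) {i j : ℕ} (h : (i, j) ∈ μ) :
    (μ.hookLength (i, j) : ℤ) = μ.rowEdge i - μ.colEdge j := by
  have hr := mem_iff_lt_rowLen.mp h
  have hc := mem_iff_lt_colLen.mp h
  have hcells : (μ.cells.filter fun d => (d.1 = i ∧ j ≤ d.2) ∨ (d.2 = j ∧ i ≤ d.1)) =
      {i} ×ˢ Finset.Ico j (μ.rowLen i) ∪ Finset.Ico (i + 1) (μ.colLen j) ×ˢ {j} := by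
    ext ⟨k, l⟩
    simp only [Finset.mem_filter, mem_cells, Finset.mem_union, Finset.mem_product,
      Finset.mem_singleton, Finset.mem_Ico]
    constructor
    · rintro ⟨hm, ⟨rfl, hl⟩ | ⟨rfl, hk⟩⟩
      · exact Or.inl ⟨rfl, hl, mem_iff_lt_rowLen.mp hm⟩
      · rcases hk.eq_or_lt with rfl | hk
        · exact Or.inl ⟨rfl, le_rfl, mem_iff_lt_rowLen.mp hm⟩
        · exact Or.inr ⟨⟨hk, mem_iff_lt_colLen.mp hm⟩, rfl⟩
    · rintro (⟨rfl, hl, hm⟩ | ⟨⟨hk, hm⟩, rfl⟩)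
      · exact ⟨mem_iff_lt_rowLen.mpr hm, Or.inl ⟨rfl, hl⟩⟩
      · exact ⟨mem_iff_lt_colLen.mpr hm, Or.inr ⟨rfl, by omega⟩⟩
  have hdisj : Disjoint ({i} ×ˢ Finset.Ico j (μ.rowLen i))
      (Finset.Ico (i + 1) (μ.colLen j) ×ˢ {j}) := by
    rw [Finset.disjoint_left]
    rintro ⟨k, l⟩ h1 h2
    simp only [Finset.mem_product, Finset.mem_singleton, Finset.mem_Ico] at h1 h2
    omega
  have hcard : μ.hookLength (i, j) = (μ.rowLen i - j) + (μ.colLen j - (i + 1)) := by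
    change (μ.cells.filter fun d => (d.1 = i ∧ j ≤ d.2) ∨ (d.2 = j ∧ i ≤ d.1)).card = _
    rw [hcells, Finset.card_union_of_disjoint hdisj]
    simp
  rw [hcard, rowEdge, colEdge]
  omega

/-- A hook of length `a` in column `j` exists exactly when the step `a` places after the edge of
column `j` is vertical. -/
theorem isCore_iff (A : Set ℕ) (μ : YoungDiagram) :
    μ.IsCore A ↔ ∀ a ∈ A, ∀ j, ∃ k, μ.colEdge k = μ.colEdge j + a := by
  constructor
  · intro h a ha j
    rcases μ.exists_rowEdge_or_exists_colEdge (μ.colEdge j + a) with ⟨i, hi⟩ | hk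
    · have hne := μ.rowEdge_ne_colEdge i j
      have hm : (i, j) ∈ μ := μ.mem_iff_colEdge_lt_rowEdge.mpr (by omega)
      have hh := μ.hookLength_eq hm
      have heq : μ.hookLength (i, j) = a := by omega
      exact absurd ha (heq ▸ h (i, j) ((mem_cells _).mpr hm))
    · exact hk
  · rintro h ⟨i, j⟩ hm ha
    obtain ⟨k, hk⟩ := h _ ha j
    rw [μ.hookLength_eq ((mem_cells _).mp hm)] at hk
    exact μ.rowEdge_ne_colEdge i k (by omega)

theorem le_iff_colLen_le {μ ν : YoungDiagram} : μ ≤ ν ↔ ∀ j, μ.colLen j ≤ ν.colLen j := by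
  constructor
  · intro h j
    by_contra! hlt
    exact lt_irrefl _ (mem_iff_lt_colLen.mp (h (mem_iff_lt_colLen.mpr hlt)))
  · rintro h ⟨i, j⟩ hm
    exact mem_iff_lt_colLen.mpr ((mem_iff_lt_colLen.mp hm).trans_le (h j))

theorem colEdge_strictMono (μ : YoungDiagram) : StrictMono μ.colEdge := by
  intro i j h
  have := μ.colLen_anti i j h.le
  rw [colEdge, colEdge]
  omega

end YoungDiagram

/-! ### Diagrams from cofinite sets. -/

section Cofinite

open scoped Classical in
theorem count_add_ncard_compl {D : Set ℕ} {n : ℕ} (hn : ∀ m ≥ n, m ∈ D) :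
    Nat.count (· ∈ D) n + Dᶜ.ncard = n := by
  have h : Dᶜ = ((Finset.range n).filter fun m => ¬ m ∈ D : Finset ℕ) := by
    ext m
    simp only [Set.mem_compl_iff, Finset.coe_filter, Finset.mem_range]
    exact ⟨fun h => ⟨by by_contra! h'; exact h (hn m h'), h⟩, fun h => h.2⟩
  rw [h, Set.ncard_coe_finset, Nat.count_eq_card_filter_range,
    Finset.card_filter_add_card_filter_not, Finset.card_range]

open scoped Classical in
theorem le_count_add_ncard_compl {D : Set ℕ} (hD : Dᶜ.Finite) (n : ℕ) :
    n ≤ Nat.count (· ∈ D) n + Dᶜ.ncard := by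
  have h : (((Finset.range n).filter fun m => ¬ m ∈ D : Finset ℕ) : Set ℕ).ncard ≤ Dᶜ.ncard :=
    Set.ncard_le_ncard (fun m hm => by simpa using (Finset.mem_filter.mp hm).2) hD
  rw [Set.ncard_coe_finset] at h
  rw [Nat.count_eq_card_filter_range]
  have := Finset.card_filter_add_card_filter_not (s := Finset.range n) (fun m => m ∈ D)
  rw [Finset.card_range] at this
  omega

theorem infinite_of_finite_compl {D : Set ℕ} (hD : Dᶜ.Finite) : D.Infinite :=
  fun h => Set.infinite_univ (Set.union_compl_self D ▸ h.union hD)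

theorem exists_forall_ge_mem {D : Set ℕ} (hD : Dᶜ.Finite) : ∃ n, ∀ m ≥ n, m ∈ D := by
  obtain ⟨N, hN⟩ := hD.bddAbove
  refine ⟨N + 1, fun m hm => ?_⟩
  by_contra h
  have := hN h
  omega

theorem nth_le_add_ncard_compl {D : Set ℕ} (hD : Dᶜ.Finite) (j : ℕ) :
    Nat.nth (· ∈ D) j ≤ j + Dᶜ.ncard := by
  classical
  have := le_count_add_ncard_compl hD (Nat.nth (· ∈ D) j)
  rwa [Nat.count_nth_of_infinite (p := (· ∈ D)) (infinite_of_finite_compl hD)] at this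

theorem nth_mem_of_finite_compl {D : Set ℕ} (hD : Dᶜ.Finite) (j : ℕ) :
    Nat.nth (· ∈ D) j ∈ D :=
  Nat.nth_mem_of_infinite (infinite_of_finite_compl hD) j

theorem nth_strictMono_of_finite_compl {D : Set ℕ} (hD : Dᶜ.Finite) :
    StrictMono (Nat.nth (· ∈ D)) :=
  Nat.nth_strictMono (infinite_of_finite_compl hD)

theorem nth_eq_add_ncard_compl {D : Set ℕ} (hD : Dᶜ.Finite) {j : ℕ}
    (h : ∀ m ≥ Nat.nth (· ∈ D) j, m ∈ D) : Nat.nth (· ∈ D) j = j + Dᶜ.ncard := by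
  classical
  have := count_add_ncard_compl h
  rw [Nat.count_nth_of_infinite (p := (· ∈ D)) (infinite_of_finite_compl hD)] at this
  exact this.symm

/-- The Young diagram whose boundary path has its horizontal steps at the positions in `D`, up to
a shift. -/
noncomputable def YoungDiagram.ofCofinite (D : Set ℕ) (hD : Dᶜ.Finite) : YoungDiagram where
  cells := by
    refine Set.Finite.toFinset
      (s := {c : ℕ × ℕ | c.1 + Nat.nth (· ∈ D) c.2 < c.2 + Dᶜ.ncard}) ?_
    obtain ⟨N, hN⟩ := exists_forall_ge_mem hD
    refine ((Finset.range Dᶜ.ncard ×ˢ Finset.range N).finite_toSet).subset ?_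
    rintro ⟨i, j⟩ h
    simp only [Set.mem_ofPred_eq] at h
    have hj := (nth_strictMono_of_finite_compl hD).le_apply (x := j)
    have : j < N := by
      by_contra! hjN
      have := nth_eq_add_ncard_compl hD (j := j) fun m hm => hN m (by omega)
      omega
    simp only [Finset.coe_product, Finset.coe_range, Set.mem_prod, Set.mem_Iio]
    omega
  isLowerSet := by
    rintro ⟨i, j⟩ ⟨k, l⟩ ⟨h1, h2⟩ h
    simp only [Set.Finite.coe_toFinset, Set.mem_ofPred_eq] at h ⊢
    have := (nth_strictMono_of_finite_compl hD).add_le_nat (j - l) l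
    simp only at h1 h2
    rw [Nat.sub_add_cancel h2] at this
    omega

/-- Below the `j`-th element of `D` lie `j` elements, hence all other smaller numbers are gaps; the
column counts the remaining gaps. -/
theorem YoungDiagram.colLen_ofCofinite {D : Set ℕ} (hD : Dᶜ.Finite) (j : ℕ) :
    (ofCofinite D hD).colLen j + Nat.nth (· ∈ D) j = j + Dᶜ.ncard := by
  have hle := nth_le_add_ncard_compl hD j
  have h (i : ℕ) : i < (ofCofinite D hD).colLen j ↔ i + Nat.nth (· ∈ D) j < j + Dᶜ.ncard := by
    rw [← mem_iff_lt_colLen, ← mem_cells]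
    simp [ofCofinite]
  have h1 := h ((ofCofinite D hD).colLen j)
  have h2 := h (j + Dᶜ.ncard - Nat.nth (· ∈ D) j)
  omega

theorem YoungDiagram.isCore_ofCofinite {A : Set ℕ} {D : Set ℕ} (hD : Dᶜ.Finite)
    (hA : ∀ a ∈ A, ∀ d ∈ D, d + a ∈ D) : (ofCofinite D hD).IsCore A := by
  classical
  rw [isCore_iff]
  intro a ha j
  have hm := hA a ha _ (nth_mem_of_finite_compl hD j)
  have hk := Nat.nth_count (p := (· ∈ D)) hm
  refine ⟨Nat.count (· ∈ D) (Nat.nth (· ∈ D) j + a), ?_⟩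
  have h1 := colLen_ofCofinite hD j
  have h2 := colLen_ofCofinite hD (Nat.count (· ∈ D) (Nat.nth (· ∈ D) j + a))
  rw [hk] at h2
  rw [colEdge, colEdge]
  omega

/-- Every core is the diagram of a cofinite set that contains `0` and is closed under translation
by the forbidden hook lengths. -/
theorem YoungDiagram.IsCore.exists_eq_ofCofinite {A : Set ℕ} {μ : YoungDiagram} (h : μ.IsCore A) :
    ∃ (D : Set ℕ) (hD : Dᶜ.Finite), 0 ∈ D ∧ (∀ a ∈ A, ∀ d ∈ D, d + a ∈ D) ∧
      μ = ofCofinite D hD := by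
  classical
  have hanti (j : ℕ) : μ.colLen j ≤ μ.colLen 0 := μ.colLen_anti 0 j (Nat.zero_le j)
  -- The column edges, shifted so that the first is `0`.
  set f : ℕ → ℕ := fun j => j + (μ.colLen 0 - μ.colLen j) with hf
  have hedge (j : ℕ) : (f j : ℤ) = μ.colEdge j + μ.colLen 0 := by
    have := hanti j
    simp only [hf, colEdge]
    omega
  have hmono : StrictMono f := by
    intro i j hij
    have := μ.colEdge_strictMono hij
    have := hedge i
    have := hedge j
    omega
  have hzero : ∀ j ≥ μ.rowLen 0, μ.colLen j = 0 := by
    intro j hj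
    have := μ.lt_rowLen_iff_lt_colLen (i := 0) (j := j)
    omega
  have hmem : ∀ n ≥ μ.rowLen 0 + μ.colLen 0, n ∈ Set.range f := by
    intro n hn
    refine ⟨n - μ.colLen 0, ?_⟩
    have := hzero (n - μ.colLen 0) (by omega)
    simp only [hf]
    omega
  have hD : (Set.range f)ᶜ.Finite := by
    refine (Set.finite_Iio (μ.rowLen 0 + μ.colLen 0)).subset fun n hn => ?_
    by_contra hlt
    exact hn (hmem n (by simpa using hlt))
  have hnth : f = Nat.nth (· ∈ Set.range f) := by
    refine (hmono.range_inj (nth_strictMono_of_finite_compl hD)).mp ?_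
    exact (Nat.range_nth_of_infinite (infinite_of_finite_compl hD)).symm
  have hcard : (Set.range f)ᶜ.ncard = μ.colLen 0 := by
    have h1 := nth_eq_add_ncard_compl hD (j := μ.rowLen 0) (by
      intro m hm
      rw [← hnth] at hm
      have := hzero _ le_rfl
      exact hmem m (by simp only [hf] at hm; omega))
    rw [← hnth] at h1
    have := hzero _ le_rfl
    simp only [hf] at h1 ⊢
    omega
  refine ⟨Set.range f, hD, ⟨0, by simp [hf]⟩, ?_, ?_⟩
  · rintro a ha _ ⟨j, rfl⟩
    obtain ⟨k, hk⟩ := (isCore_iff A μ).mp h a ha j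
    refine ⟨k, ?_⟩
    have := hedge k
    have := hedge j
    omega
  · have hcol (j : ℕ) : μ.colLen j = (ofCofinite (Set.range f) hD).colLen j := by
      have h1 := colLen_ofCofinite hD j
      rw [← hnth, hcard] at h1
      have := hanti j
      simp only [hf] at h1 ⊢
      omega
    exact le_antisymm (le_iff_colLen_le.mpr fun j => (hcol j).le)
      (le_iff_colLen_le.mpr fun j => (hcol j).ge)

theorem YoungDiagram.ofCofinite_le_iff {D E : Set ℕ} (hD : Dᶜ.Finite) (hE : Eᶜ.Finite) :
    ofCofinite D hD ≤ ofCofinite E hE ↔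
      ∀ j, Nat.nth (· ∈ E) j + Dᶜ.ncard ≤ Nat.nth (· ∈ D) j + Eᶜ.ncard := by
  rw [le_iff_colLen_le]
  refine forall_congr' fun j => ?_
  have h1 := colLen_ofCofinite hD j
  have h2 := colLen_ofCofinite hE j
  omega

end Cofinite

/-! ### Counting along residue classes. -/

section ResidueSystem

/-- The quotient is the ceiling of `(t - w) / a`, which counts the terms of `w, w + a, …` below `t`.
-/
theorem add_sub_one_div_succ {a : ℕ} (ha : 0 < a) (t w : ℕ) :
    (t + 1 - w + (a - 1)) / a =
      (t - w + (a - 1)) / a + if w ≤ t ∧ t ≡ w [MOD a] then 1 else 0 := by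
  by_cases hw : w ≤ t
  · have h1 : t + 1 - w + (a - 1) = (t - w + (a - 1)) + 1 := by omega
    have h2 : a ∣ (t - w + (a - 1)) + 1 ↔ t ≡ w [MOD a] := by
      have h3 : (t - w + (a - 1)) + 1 = t - w + a := by omega
      rw [h3, Nat.dvd_add_self_right, Nat.ModEq.comm, Nat.modEq_iff_dvd' hw]
    rw [h1, Nat.succ_div]
    simp only [h2, hw, true_and]
  · have h1 : t + 1 - w = 0 := by omega
    have h2 : t - w = 0 := by omega
    simp [h1, h2, hw]

open scoped Classical in
/-- Counting the elements of a union of residue rays `{w k, w k + a, w k + 2 * a, …}`. -/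
theorem count_eq_sum_of_residueRays {a : ℕ} (ha : 0 < a) {D : Set ℕ} {w : ℕ → ℕ}
    (hinj : ∀ k < a, ∀ l < a, w k ≡ w l [MOD a] → k = l)
    (hD : ∀ n, n ∈ D ↔ ∃ k < a, w k ≤ n ∧ n ≡ w k [MOD a]) (t : ℕ) :
    Nat.count (· ∈ D) t = ∑ k ∈ Finset.range a, (t - w k + (a - 1)) / a := by
  induction t with
  | zero =>
    have : (a - 1) / a = 0 := Nat.div_eq_of_lt (by omega)
    simp [this]
  | succ t ih =>
    rw [Nat.count_succ, ih]
    simp_rw [add_sub_one_div_succ ha t]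
    rw [Finset.sum_add_distrib]
    congr 1
    rw [hD t]
    split_ifs with h
    · obtain ⟨k, hk, hkt, hmod⟩ := h
      rw [Finset.sum_eq_single k]
      · simp [hkt, hmod]
      · intro l hl hne
        refine if_neg fun h => hne ?_
        exact hinj l (Finset.mem_range.mp hl) k hk (h.2.symm.trans hmod)
      · intro h
        exact absurd (Finset.mem_range.mpr hk) h
    · refine (Finset.sum_eq_zero fun k hk => if_neg fun h' => h ?_).symm
      exact ⟨k, Finset.mem_range.mp hk, h'⟩

theorem natCast_sub_add_sub_one_div {a t w : ℕ} (ha : 0 < a) (h : w ≤ t) :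
    (((t - w + (a - 1)) / a : ℕ) : ℤ) = ((t : ℤ) - w + (a - 1)) / a := by
  push_cast [h, Nat.cast_sub (show 1 ≤ a from ha)]
  rfl

theorem le_natCast_sub_add_sub_one_div {a : ℕ} (ha : 0 < a) (t w : ℕ) :
    ((t : ℤ) - w + (a - 1)) / a ≤ (((t - w + (a - 1)) / a : ℕ) : ℤ) := by
  rcases le_total w t with h | h
  · exact (natCast_sub_add_sub_one_div ha h).ge
  · have h1 : ((t : ℤ) - w + (a - 1)) / a < 1 :=
      Int.ediv_lt_of_lt_mul (by omega) (by omega)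
    exact (Int.lt_add_one_iff.mp h1).trans (Int.natCast_nonneg _)

/-- Over `ℤ` the ceilings may be negative, and this makes the formula exact for every `t`: it holds
for large `t`, and shifting `t` by `a * M` adds `M` to each term. -/
theorem sum_residueRays_eq {a : ℕ} (ha : 0 < a) {D : Set ℕ} (hfin : Dᶜ.Finite) {w : ℕ → ℕ}
    (hinj : ∀ k < a, ∀ l < a, w k ≡ w l [MOD a] → k = l)
    (hD : ∀ n, n ∈ D ↔ ∃ k < a, w k ≤ n ∧ n ≡ w k [MOD a]) (t : ℕ) :
    ∑ k ∈ Finset.range a, ((t : ℤ) - w k + (a - 1)) / a = t - Dᶜ.ncard := by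
  classical
  obtain ⟨N, hN⟩ := exists_forall_ge_mem hfin
  set M := N + ∑ k ∈ Finset.range a, w k with hM
  have hMa : M ≤ a * M := Nat.le_mul_of_pos_left M ha
  have h1 := count_add_ncard_compl (n := t + a * M) fun m hm => hN m (by omega)
  rw [count_eq_sum_of_residueRays ha hinj hD] at h1
  have h2 : ((∑ k ∈ Finset.range a, (t + a * M - w k + (a - 1)) / a : ℕ) : ℤ) =
      ∑ k ∈ Finset.range a, (((t : ℤ) - w k + (a - 1)) / a + M) := by
    rw [Nat.cast_sum]
    refine Finset.sum_congr rfl fun k hk => ?_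
    have hwk : w k ≤ ∑ k ∈ Finset.range a, w k :=
      Finset.single_le_sum (fun _ _ => Nat.zero_le _) hk
    rw [natCast_sub_add_sub_one_div ha (by omega),
      ← Int.add_mul_ediv_left _ _ (by omega : (a : ℤ) ≠ 0)]
    congr 1
    push_cast
    ring
  rw [Finset.sum_add_distrib, Finset.sum_const, Finset.card_range, nsmul_eq_mul] at h2
  have h3 : ((a * M : ℕ) : ℤ) = a * M := Nat.cast_mul a M
  omega

/-- If a partial sum were positive, some term in it would be positive, so all later terms would be
nonnegative and the total positive. -/
theorem sum_range_nonpos_of_singleCrossing {a p : ℕ} {z : ℕ → ℤ} (hp : p ≤ a)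
    (hsum : ∑ k ∈ Finset.range a, z k = 0)
    (hz : ∀ k l, k ≤ l → l < a → 0 < z k → 0 ≤ z l) : ∑ k ∈ Finset.range p, z k ≤ 0 := by
  by_contra! hpos
  obtain ⟨k, hk, hzk⟩ : ∃ k ∈ Finset.range p, 0 < z k := by
    by_contra! h
    exact hpos.not_ge (Finset.sum_nonpos h)
  rw [Finset.mem_range] at hk
  have h := Finset.sum_le_sum_of_subset_of_nonneg (f := z) (Finset.range_subset_range.mpr hp)
    fun l hl hlp => hz k l (by simp at hlp; omega) (Finset.mem_range.mp hl) hzk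
  omega

open scoped Classical in
/-- Among unions of residue rays modulo `a` whose sorted starting points begin at `0` and have
gaps at most `b`, the one with starting points `0, b, 2 * b, …` dominates all others. -/
theorem count_le_count_add_of_gap_le {a b m : ℕ} (ha : 0 < a) {D E : Set ℕ} (hDfin : Dᶜ.Finite)
    (hEfin : Eᶜ.Finite) {w : ℕ → ℕ} (hm : Dᶜ.ncard + m = Eᶜ.ncard)
    (hDinj : ∀ k < a, ∀ l < a, w k ≡ w l [MOD a] → k = l)
    (hD : ∀ n, n ∈ D ↔ ∃ k < a, w k ≤ n ∧ n ≡ w k [MOD a])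
    (hEinj : ∀ k < a, ∀ l < a, k * b ≡ l * b [MOD a] → k = l)
    (hE : ∀ n, n ∈ E ↔ ∃ k < a, k * b ≤ n ∧ n ≡ k * b [MOD a])
    (hmono : ∀ k l, k ≤ l → l < a → w k ≤ w l)
    (hgap : ∀ k, k + 1 < a → w (k + 1) ≤ w k + b) (t : ℕ) :
    Nat.count (· ∈ D) t ≤ Nat.count (· ∈ E) (t + m) := by
  have haz : (0 : ℤ) < a := by exact_mod_cast ha
  have hgap' : ∀ k l, k ≤ l → l < a → w l + k * b ≤ w k + l * b := by
    intro k l hkl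
    induction l, hkl using Nat.le_induction with
    | base => intro _; exact le_rfl
    | succ l hkl ih =>
      intro hl
      have := ih (by omega)
      have := hgap l hl
      rw [add_mul, one_mul]
      omega
  -- Only the first `p` rays can meet `D` below `t`; on these the signed and truncated counts agree.
  obtain ⟨p, hpa, hp1, hp2⟩ : ∃ p ≤ a, (∀ k < p, w k ≤ t) ∧ ∀ k, p ≤ k → k < a → t ≤ w k := by
    have hex : ∃ p, p = a ∨ t < w p := ⟨a, Or.inl rfl⟩
    have hlt : ∀ k < Nat.find hex, ¬ (k = a ∨ t < w k) := fun k hk => Nat.find_min hex hk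
    have hle : Nat.find hex ≤ a := Nat.find_min' hex (Or.inl rfl)
    refine ⟨Nat.find hex, hle, fun k hk => ?_, fun k hk hka => ?_⟩
    · have := hlt k hk
      omega
    · have h1 := hmono _ k hk hka
      rcases Nat.find_spec hex with h | h <;> omega
  have hsum : ∑ k ∈ Finset.range p, (((t : ℤ) - w k + (a - 1)) / a -
      (((t + m : ℕ) : ℤ) - (k * b : ℕ) + (a - 1)) / a) ≤ 0 := by
    refine sum_range_nonpos_of_singleCrossing hpa ?_ fun k l hkl hl hpos => ?_
    · rw [Finset.sum_sub_distrib, sum_residueRays_eq ha hDfin hDinj hD,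
        sum_residueRays_eq (w := fun k => k * b) ha hEfin hEinj hE]
      omega
    · have h1 := hgap' k l hkl hl
      have h2 : ¬ ((t : ℤ) - w k + (a - 1) ≤ ((t + m : ℕ) : ℤ) - (k * b : ℕ) + (a - 1)) := by
        intro h
        have := Int.ediv_le_ediv haz h
        omega
      -- `w k - k * b` is nonincreasing in `k`, whence the single crossing.
      have h3 : ((t + m : ℕ) : ℤ) - (l * b : ℕ) + (a - 1) ≤ (t : ℤ) - w l + (a - 1) := by
        zify at h1 ⊢
        push_cast at h2
        omega
      have := Int.ediv_le_ediv haz h3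
      omega
  rw [Finset.sum_sub_distrib, sub_nonpos] at hsum
  rw [count_eq_sum_of_residueRays ha hDinj hD,
    count_eq_sum_of_residueRays (w := fun k => k * b) ha hEinj hE]
  have h1 : ∑ k ∈ Finset.range a, (t - w k + (a - 1)) / a =
      ∑ k ∈ Finset.range p, (t - w k + (a - 1)) / a := by
    refine (Finset.sum_subset (Finset.range_subset_range.mpr hpa) fun k hk hkp => ?_).symm
    rw [Finset.mem_range] at hk hkp
    have := hp2 k (by omega) hk
    rw [Nat.sub_eq_zero_of_le this, zero_add]
    exact Nat.div_eq_of_lt (by omega)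
  have h2 : ∑ k ∈ Finset.range p, (t + m - k * b + (a - 1)) / a ≤
      ∑ k ∈ Finset.range a, (t + m - k * b + (a - 1)) / a :=
    Finset.sum_le_sum_of_subset (Finset.range_subset_range.mpr hpa)
  rw [h1]
  refine le_trans ?_ h2
  zify
  calc ∑ k ∈ Finset.range p, (((t - w k + (a - 1)) / a : ℕ) : ℤ)
      = ∑ k ∈ Finset.range p, ((t : ℤ) - w k + (a - 1)) / a :=
        Finset.sum_congr rfl fun k hk =>
          natCast_sub_add_sub_one_div ha (hp1 k (Finset.mem_range.mp hk))
    _ ≤ _ := hsum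
    _ ≤ ∑ k ∈ Finset.range p, (((t + m - k * b + (a - 1)) / a : ℕ) : ℤ) :=
        Finset.sum_le_sum fun k _ => le_natCast_sub_add_sub_one_div ha _ _

theorem exists_lt_mul_modEq {a b : ℕ} (ha : 0 < a) (hab : Nat.Coprime a b) (n : ℕ) :
    ∃ k < a, n ≡ k * b [MOD a] := by
  obtain ⟨x, hx0, hxb⟩ := Nat.chineseRemainder hab n 0
  obtain ⟨q, rfl⟩ := (Nat.modEq_zero_iff_dvd).mp hxb
  refine ⟨q % a, Nat.mod_lt _ ha, ?_⟩
  rw [mul_comm] at hx0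
  exact hx0.symm.trans ((Nat.mod_modEq q a).symm.mul_right b)

theorem eq_of_mul_modEq_mul {a b k l : ℕ} (hab : Nat.Coprime a b) (hk : k < a) (hl : l < a)
    (h : k * b ≡ l * b [MOD a]) : k = l :=
  (Nat.ModEq.cancel_right_of_coprime hab h).eq_of_lt_of_lt hk hl

theorem add_mul_mem_of_add_mem {a : ℕ} {D : Set ℕ} (h : ∀ d ∈ D, d + a ∈ D) {d : ℕ} (hd : d ∈ D)
    (k : ℕ) : d + k * a ∈ D := by
  induction k with
  | zero => simpa using hd
  | succ k ih => rw [add_mul, one_mul, ← add_assoc]; exact h _ ih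

theorem mem_of_modEq_of_add_mem {a : ℕ} {D : Set ℕ} (h : ∀ d ∈ D, d + a ∈ D) {d n : ℕ}
    (hd : d ∈ D) (hdn : d ≤ n) (hmod : n ≡ d [MOD a]) : n ∈ D := by
  obtain ⟨q, hq⟩ := (Nat.modEq_iff_dvd' hdn).mp hmod.symm
  have := add_mul_mem_of_add_mem h hd q
  rwa [mul_comm, ← hq, Nat.add_sub_cancel' hdn] at this

/-- The sorted Apéry set with respect to `a` of a set closed under adding `a` and `b` has gaps
at most `b`. -/
theorem exists_residueRays_gap_le {a b : ℕ} (ha : 0 < a) (hab : Nat.Coprime a b) {D : Set ℕ}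
    (h0 : 0 ∈ D) (hDa : ∀ d ∈ D, d + a ∈ D) (hDb : ∀ d ∈ D, d + b ∈ D) :
    ∃ w : ℕ → ℕ, (∀ k < a, ∀ l < a, w k ≡ w l [MOD a] → k = l) ∧
      (∀ n, n ∈ D ↔ ∃ k < a, w k ≤ n ∧ n ≡ w k [MOD a]) ∧
      (∀ k l, k ≤ l → l < a → w k ≤ w l) ∧ ∀ k, k + 1 < a → w (k + 1) ≤ w k + b := by
  classical
  have hex (j : ℕ) : ∃ n, n ∈ D ∧ n ≡ j * b [MOD a] :=
    ⟨0 + j * b, add_mul_mem_of_add_mem hDb h0 j, by rw [zero_add]⟩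
  obtain ⟨u, huD, humod, hmin⟩ : ∃ u : ℕ → ℕ, (∀ j, u j ∈ D) ∧ (∀ j, u j ≡ j * b [MOD a]) ∧
      ∀ j, ∀ n ∈ D, n ≡ j * b [MOD a] → u j ≤ n :=
    ⟨fun j => Nat.find (hex j), fun j => (Nat.find_spec (hex j)).1,
      fun j => (Nat.find_spec (hex j)).2, fun j n hn hmod => Nat.find_min' (hex j) ⟨hn, hmod⟩⟩
  have hinj : ∀ i < a, ∀ j < a, u i ≡ u j [MOD a] → i = j := fun i hi j hj h =>
    eq_of_mul_modEq_mul hab hi hj ((humod i).symm.trans (h.trans (humod j)))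
  have hu0 : u 0 = 0 := Nat.le_zero.mp (hmin 0 0 h0 (by rw [zero_mul]))
  have husucc (j : ℕ) : u (j + 1) ≤ u j + b :=
    hmin _ _ (hDb _ (huD j)) (by rw [add_mul, one_mul]; exact (humod j).add_right b)
  set P : Finset ℕ := (Finset.range a).image u with hP
  have hcard : P.card = a := by
    rw [hP, Finset.card_image_of_injOn, Finset.card_range]
    intro i hi j hj h
    simp only [Finset.coe_range, Set.mem_Iio] at hi hj
    exact hinj i hi j hj (by rw [h])
  have hPfin : (Set.ofPred (· ∈ P)).Finite := P.finite_toSet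
  have hPcard : hPfin.toFinset.card = a := by
    rw [← hcard]
    congr 1
    ext x
    simp
  have hwmem (k : ℕ) (hk : k < a) : Nat.nth (· ∈ P) k ∈ P :=
    Nat.nth_mem_of_lt_card hPfin (by omega)
  have hwmono : StrictMonoOn (Nat.nth (· ∈ P)) (Set.Iio a) := by
    have := Nat.nth_strictMonoOn hPfin
    rwa [hPcard] at this
  have hwex (j : ℕ) (hj : j < a) : ∃ k < a, Nat.nth (· ∈ P) k = u j := by
    obtain ⟨k, hk, h⟩ := Nat.exists_lt_card_finite_nth_eq hPfin
      (Finset.mem_image_of_mem u (Finset.mem_range.mpr hj))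
    exact ⟨k, by omega, h⟩
  refine ⟨Nat.nth (· ∈ P), fun k hk l hl h => ?_, fun n => ⟨fun hn => ?_, ?_⟩,
    fun k l hkl hl => hwmono.monotoneOn (Set.mem_Iio.mpr (by omega)) (Set.mem_Iio.mpr hl) hkl,
    fun k hk => ?_⟩
  · obtain ⟨i, hi, hik⟩ := Finset.mem_image.mp (hwmem k hk)
    obtain ⟨j, hj, hjl⟩ := Finset.mem_image.mp (hwmem l hl)
    rw [Finset.mem_range] at hi hj
    rw [← hik, ← hjl] at h
    have hij := hinj i hi j hj h
    subst hij
    exact hwmono.injOn (Set.mem_Iio.mpr hk) (Set.mem_Iio.mpr hl) (hik.symm.trans hjl)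
  · obtain ⟨j, hj, hmod⟩ := exists_lt_mul_modEq ha hab n
    obtain ⟨k, hk, hkj⟩ := hwex j hj
    refine ⟨k, hk, ?_, ?_⟩ <;> rw [hkj]
    · exact hmin j n hn hmod
    · exact hmod.trans (humod j).symm
  · rintro ⟨k, hk, hkn, hmod⟩
    obtain ⟨i, -, hik⟩ := Finset.mem_image.mp (hwmem k hk)
    rw [← hik] at hkn hmod
    exact mem_of_modEq_of_add_mem hDa (huD i) hkn hmod
  · by_contra! hlt
    -- The walk `u 0 = 0, u 1, …` climbs by at most `b` per step, so it cannot jump over a gap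
    -- larger than `b`.
    have hall : ∀ j < a, u j ≤ Nat.nth (· ∈ P) k := by
      intro j
      induction j with
      | zero => intro _; rw [hu0]; exact Nat.zero_le _
      | succ j ih =>
        intro hj
        have h1 := ih (by omega)
        have h2 := husucc j
        exact Nat.le_nth_of_lt_nth_succ (by omega)
          (Finset.mem_image_of_mem u (Finset.mem_range.mpr hj))
    obtain ⟨j, hj, hjk⟩ := Finset.mem_image.mp (hwmem (k + 1) hk)
    have := hall j (Finset.mem_range.mp hj)
    omega

end ResidueSystem

/-! ### Semigroups with two generators. -/

theorem mem_closure_pair_iff_exists_residue {a b : ℕ} (ha : 0 < a) (n : ℕ) :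
    n ∈ AddSubmonoid.closure {a, b} ↔ ∃ k < a, k * b ≤ n ∧ n ≡ k * b [MOD a] := by
  simp only [AddSubmonoid.mem_closure_pair, smul_eq_mul]
  constructor
  · rintro ⟨x, y, rfl⟩
    have hy := Nat.mod_add_div y a
    refine ⟨y % a, Nat.mod_lt _ ha, ?_, ?_⟩
    · have := Nat.mul_le_mul_right b (Nat.mod_le y a)
      omega
    · have h1 : x * a + y * b ≡ 0 + y * b [MOD a] :=
        ((Nat.modEq_zero_iff_dvd).mpr (dvd_mul_left a x)).add_right _
      rw [zero_add] at h1
      exact h1.trans ((Nat.mod_modEq y a).symm.mul_right b)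
  · rintro ⟨k, -, hle, hmod⟩
    obtain ⟨q, hq⟩ := (Nat.modEq_iff_dvd' hle).mp hmod.symm
    exact ⟨q, k, by rw [mul_comm q a]; omega⟩

theorem finite_compl_closure_of_coprime {A : Set ℕ} {a b : ℕ} (ha : a ∈ A) (hb : b ∈ A)
    (hab : Nat.Coprime a b) : ((AddSubmonoid.closure A : Set ℕ)ᶜ).Finite := by
  obtain ⟨N, hN⟩ := Nat.exists_mem_closure_of_ge A
  have h1 : Nat.setGcd A = 1 := Nat.eq_one_of_dvd_coprimes hab
    (Nat.setGcd_dvd_of_mem ha) (Nat.setGcd_dvd_of_mem hb)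
  refine (Set.finite_Iio N).subset fun n hn => ?_
  by_contra hlt
  exact hn (hN n (by simpa using hlt) (by rw [h1]; exact one_dvd n))

theorem closure_subset_of_add_mem {A D : Set ℕ} (h0 : 0 ∈ D)
    (h : ∀ a ∈ A, ∀ d ∈ D, d + a ∈ D) : (AddSubmonoid.closure A : Set ℕ) ⊆ D := by
  intro n hn
  induction hn using AddSubmonoid.closure_induction_right with
  | zero => exact h0
  | add_right x _ y hy ih => exact h y hy x ih

/-- For coprime `a` and `b`, the diagram of the numerical semigroup generated by `a` and `b`
contains the diagram of every set that contains `0` and is closed under adding `a` and `b`. -/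
theorem YoungDiagram.ofCofinite_le_ofCofinite_closure_pair {a b : ℕ} (ha : 0 < a)
    (hab : Nat.Coprime a b) {D : Set ℕ} (hD : Dᶜ.Finite) (h0 : 0 ∈ D)
    (hDa : ∀ d ∈ D, d + a ∈ D) (hDb : ∀ d ∈ D, d + b ∈ D)
    (hE : ((AddSubmonoid.closure {a, b} : Set ℕ)ᶜ).Finite) :
    ofCofinite D hD ≤ ofCofinite _ hE := by
  classical
  have hsub : (AddSubmonoid.closure {a, b} : Set ℕ) ⊆ D :=
    closure_subset_of_add_mem h0 (by rintro _ (rfl | rfl) <;> assumption)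
  obtain ⟨m, hm⟩ := Nat.exists_eq_add_of_le
    (Set.ncard_le_ncard (Set.compl_subset_compl.mpr hsub) hE)
  obtain ⟨w, hinj, hmem, hmono, hgap⟩ := exists_residueRays_gap_le ha hab h0 hDa hDb
  rw [ofCofinite_le_iff]
  intro j
  have h1 := count_le_count_add_of_gap_le ha hD hE hm.symm hinj hmem
    (fun k hk l hl h => eq_of_mul_modEq_mul hab hk hl h)
    (mem_closure_pair_iff_exists_residue ha) hmono hgap (Nat.nth (· ∈ D) j + 1)
  rw [Nat.count_succ, if_pos (nth_mem_of_finite_compl hD j),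
    Nat.count_nth_of_infinite (p := (· ∈ D)) (infinite_of_finite_compl hD)] at h1
  have h2 := Nat.nth_lt_of_lt_count (Nat.lt_of_succ_le h1)
  omega

/-! ### Non-symmetry with three generators. -/

theorem mem_closure_triple_iff {a b c n : ℕ} :
    n ∈ AddSubmonoid.closure {a, b, c} ↔ ∃ x y z, n = x * a + y * b + z * c := by
  rw [Set.insert_eq, AddSubmonoid.closure_union, AddSubmonoid.mem_sup]
  simp only [AddSubmonoid.mem_closure_pair, AddSubmonoid.mem_closure_singleton, smul_eq_mul]
  constructor
  · rintro ⟨_, ⟨x, rfl⟩, _, ⟨y, z, rfl⟩, rfl⟩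
    exact ⟨x, y, z, by ring⟩
  · rintro ⟨x, y, z, rfl⟩
    exact ⟨_, ⟨x, rfl⟩, _, ⟨y, z, rfl⟩, by ring⟩

theorem exists_minimal_pos_mul_eq (a b c : ℕ) (ha : 0 < a) :
    ∃ r x z, 0 < r ∧ r ≤ a ∧ r * b = x * a + z * c ∧
      ∀ k x z, 0 < k → k * b = x * a + z * c → r ≤ k := by
  classical
  have hex : ∃ r, 0 < r ∧ ∃ x z, r * b = x * a + z * c := ⟨a, ha, b, 0, by ring⟩
  obtain ⟨hpos, x, z, h⟩ := Nat.find_spec hex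
  exact ⟨Nat.find hex, x, z, hpos, Nat.find_min' hex ⟨ha, b, 0, by ring⟩, h,
    fun k x z hk hkb => Nat.find_min' hex ⟨hk, x, z, hkb⟩⟩

/-- If `c` is not in the semigroup generated by `a` and `b`, then some multiple of `b` smaller than
`a * b` lies in the semigroup generated by `a` and `c`. -/
theorem exists_lt_mul_eq_of_notMem {a b c : ℕ} (ha : 0 < a) (hab : Nat.Coprime a b)
    (hc : ∀ x y, c ≠ x * a + y * b) : ∃ k x z, 0 < k ∧ k < a ∧ k * b = x * a + z * c := by
  obtain ⟨k, hk, hmod⟩ := exists_lt_mul_modEq ha hab c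
  have hlt : c < k * b := by
    by_contra! hle
    obtain ⟨q, hq⟩ := (Nat.modEq_iff_dvd' hle).mp hmod.symm
    exact hc q k (by rw [mul_comm q a]; omega)
  obtain ⟨q, hq⟩ := (Nat.modEq_iff_dvd' hlt.le).mp hmod
  refine ⟨k, q, 1, Nat.pos_of_ne_zero ?_, hk, by rw [mul_comm q a]; omega⟩
  rintro rfl
  omega

/-- A numerical semigroup generated by three pairwise coprime integers none of which is redundant
is not symmetric. -/
theorem not_symmetric_closure_triple {a b c F : ℕ} (ha : 0 < a) (hab : a < b) (hbc : b < c)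
    (hcop_ab : Nat.Coprime a b) (hcop_ac : Nat.Coprime a c) (hcop_bc : Nat.Coprime b c)
    (hc : ∀ x y, c ≠ x * a + y * b) (hF : F ∉ AddSubmonoid.closure {a, b, c})
    (hgt : ∀ n > F, n ∈ AddSubmonoid.closure {a, b, c})
    (hsymm : ∀ n ∉ AddSubmonoid.closure {a, b, c},
      ∃ s ∈ AddSubmonoid.closure {a, b, c}, s + n = F) : False := by
  simp only [mem_closure_triple_iff] at hF hgt hsymm
  obtain ⟨rb, xb, zb, hrb, -, hrb_eq, hrb_min⟩ := exists_minimal_pos_mul_eq a b c ha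
  obtain ⟨rc, xc, yc, hrc, hrc_le, hrc_eq, hrc_min⟩ := exists_minimal_pos_mul_eq a c b ha
  obtain ⟨ra, ya, za, hra, hra_le, hra_eq, hra_min⟩ :=
    exists_minimal_pos_mul_eq b a c (ha.trans hab)
  have hrb_lt : rb < a := by
    obtain ⟨k, x, z, hk, hka, h⟩ := exists_lt_mul_eq_of_notMem ha hcop_ab hc
    exact (hrb_min k x z hk h).trans_lt hka
  have hxb : 0 < xb := by
    refine Nat.pos_of_ne_zero ?_
    rintro rfl
    have hdvd : c ∣ rb * b := ⟨zb, by rw [hrb_eq]; ring⟩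
    have := Nat.le_of_dvd hrb (hcop_bc.symm.dvd_of_dvd_mul_right hdvd)
    omega
  have hxc : 0 < xc := by
    refine Nat.pos_of_ne_zero ?_
    rintro rfl
    have hdvd : b ∣ rc * c := ⟨yc, by rw [hrc_eq]; ring⟩
    have := Nat.le_of_dvd hrc (hcop_bc.dvd_of_dvd_mul_right hdvd)
    omega
  -- The complement of an element of the Apéry set lies in the semigroup.
  have hcompl (u : ℕ) (hu : ∀ x y z, u ≠ (x + 1) * a + y * b + z * c) :
      ∃ x y z, F + a = u + (x * a + y * b + z * c) := by
    rcases le_or_gt a u with hau | hau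
    · obtain ⟨s, ⟨x, y, z, rfl⟩, h⟩ := hsymm (u - a) (by
        rintro ⟨x, y, z, h⟩
        exact hu x y z (by rw [add_mul, one_mul]; omega))
      exact ⟨x, y, z, by omega⟩
    · obtain ⟨x, y, z, h⟩ := hgt (F + a - u) (by omega)
      exact ⟨x, y, z, by omega⟩
  have hFa (x y z : ℕ) : F + a ≠ (x + 1) * a + y * b + z * c := by
    intro h
    rw [add_mul, one_mul] at h
    exact hF ⟨x, y, z, by omega⟩
  -- If a representation of `(rb - 1) * b` used `a`, cancelling its copies of `b` would contradict
  -- the minimality of `rb`.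
  obtain ⟨x1, y1, z1, h1⟩ := hcompl ((rb - 1) * b) (by
    intro x y z h
    have hlt : y < rb - 1 := by
      by_contra! hle
      have := Nat.mul_le_mul_right b hle
      rw [add_mul, one_mul] at h
      omega
    obtain ⟨k, hk⟩ := Nat.exists_eq_add_of_lt hlt
    have := hrb_min (k + 1) (x + 1) z (Nat.succ_pos k) (by
      rw [hk] at h
      linarith)
    omega)
  obtain ⟨x2, y2, z2, h2⟩ := hcompl ((rc - 1) * c) (by
    intro x y z h
    have hlt : z < rc - 1 := by
      by_contra! hle
      have := Nat.mul_le_mul_right c hle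
      rw [add_mul, one_mul] at h
      omega
    obtain ⟨k, hk⟩ := Nat.exists_eq_add_of_lt hlt
    have := hrc_min (k + 1) (x + 1) y (Nat.succ_pos k) (by
      rw [hk] at h
      linarith)
    omega)
  obtain ⟨p, rfl⟩ : ∃ p, rb = p + 1 := ⟨rb - 1, by omega⟩
  obtain ⟨q, rfl⟩ : ∃ q, rc = q + 1 := ⟨rc - 1, by omega⟩
  obtain ⟨xb, rfl⟩ : ∃ x, xb = x + 1 := ⟨xb - 1, by omega⟩
  obtain ⟨xc, rfl⟩ : ∃ x, xc = x + 1 := ⟨xc - 1, by omega⟩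
  simp only [Nat.add_sub_cancel] at h1 h2
  -- No representation of `F + a` uses `a`, nor too many copies of `b` or of `c`.
  have hrep (x y z : ℕ) (h : F + a = x * a + y * b + z * c) : x = 0 ∧ y ≤ p ∧ z ≤ q := by
    refine ⟨?_, ?_, ?_⟩
    · by_contra hx
      obtain ⟨x, rfl⟩ := Nat.exists_eq_succ_of_ne_zero hx
      exact hFa x y z h
    · by_contra! hy
      obtain ⟨k, rfl⟩ := Nat.exists_eq_add_of_lt hy
      exact hFa (x + xb) k (z + zb) (by linarith)
    · by_contra! hz
      obtain ⟨k, rfl⟩ := Nat.exists_eq_add_of_lt hz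
      exact hFa (x + xc) (y + yc) k (by linarith)
  obtain ⟨rfl, hy1, hz1⟩ := hrep x1 (p + y1) z1 (by linarith)
  obtain ⟨rfl, hy2, hz2⟩ := hrep x2 y2 (q + z2) (by linarith)
  obtain rfl : y1 = 0 := by omega
  obtain rfl : z2 = 0 := by omega
  -- If `y2 < p`, equating the two representations makes `(p - y2) * b` a multiple of `c`, against
  -- the minimality of `rb`.
  have hw : F + a = p * b + q * c := by
    rcases hy2.eq_or_lt with rfl | hlt
    · linarith
    · obtain ⟨k, rfl⟩ := Nat.exists_eq_add_of_lt hlt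
      obtain ⟨l, rfl⟩ := Nat.exists_eq_add_of_le hz1
      have := hrb_min (k + 1) 0 l (Nat.succ_pos k) (by linarith)
      omega
  -- Subtracting the minimal relation for `a` from the representation gives a contradiction.
  rcases Nat.lt_or_ge p ya with hya | hya
  · obtain ⟨k, rfl⟩ := Nat.exists_eq_add_of_lt hya
    -- The relation for `b` replaces `p + 1` copies of `b`; cancelling `a` then contradicts the
    -- minimality of `ra` unless nothing but copies of `a` remains.
    have heq : ra * a = (xb + 1) * a + (k * b + (za + zb) * c) := by linarith
    rcases Nat.lt_or_ge (xb + 1) ra with hlt | hge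
    · obtain ⟨l, rfl⟩ := Nat.exists_eq_add_of_lt hlt
      have := hra_min (l + 1) k (za + zb) (Nat.succ_pos l) (by linarith)
      omega
    · have hmul := Nat.mul_le_mul_right a hge
      have hz0 : (za + zb) * c = 0 := by omega
      have hzb : zb = 0 := by
        rcases Nat.mul_eq_zero.mp hz0 with h | h <;> omega
      subst hzb
      have hdvd : a ∣ (p + 1) * b := ⟨xb + 1, by rw [hrb_eq]; ring⟩
      have := Nat.le_of_dvd hrb (hcop_ab.dvd_of_dvd_mul_right hdvd)
      omega
  rcases Nat.lt_or_ge q za with hza | hza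
  · obtain ⟨k, rfl⟩ := Nat.exists_eq_add_of_lt hza
    have heq : ra * a = (xc + 1) * a + ((ya + yc) * b + k * c) := by linarith
    rcases Nat.lt_or_ge (xc + 1) ra with hlt | hge
    · obtain ⟨l, rfl⟩ := Nat.exists_eq_add_of_lt hlt
      have := hra_min (l + 1) (ya + yc) k (Nat.succ_pos l) (by linarith)
      omega
    · have hmul := Nat.mul_le_mul_right a hge
      have hz0 : (ya + yc) * b = 0 := by omega
      have hk0 : k * c = 0 := by omega
      have hya0 : ya = 0 := by
        rcases Nat.mul_eq_zero.mp hz0 with h | h <;> omega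
      subst hya0
      have hdvd : c ∣ ra * a := ⟨q + k + 1, by rw [hra_eq]; ring⟩
      have := Nat.le_of_dvd hra (hcop_ac.symm.dvd_of_dvd_mul_right hdvd)
      omega
  · obtain ⟨k, rfl⟩ := Nat.exists_eq_add_of_le hya
    obtain ⟨l, rfl⟩ := Nat.exists_eq_add_of_le hza
    obtain ⟨r, rfl⟩ : ∃ r, ra = r + 1 := ⟨ra - 1, by omega⟩
    exact hFa r k l (by linarith)

/-! ### UM sets and symmetry; the equivalence. -/

/-- If the numerical semigroup generated by `A` has largest gap `F` and `A` is UM, then the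
semigroup is symmetric. -/
theorem IsUM.symmetric {A : Set ℕ} (h : IsUM A)
    (hfin : ((AddSubmonoid.closure A : Set ℕ)ᶜ).Finite) {F : ℕ}
    (hF : F ∉ AddSubmonoid.closure A) (hgt : ∀ n > F, n ∈ AddSubmonoid.closure A) {n : ℕ}
    (hn : n ∉ AddSubmonoid.closure A) : ∃ s ∈ AddSubmonoid.closure A, s + n = F := by
  classical
  set S : Set ℕ := (AddSubmonoid.closure A : Set ℕ) with hS
  have hSA : ∀ a ∈ A, ∀ d ∈ S, d + a ∈ S := fun a ha d hd =>
    add_mem hd (AddSubmonoid.subset_closure ha)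
  -- The conjugate set.
  set D : Set ℕ := {y | ∀ s ∈ S, s + y ≠ F} with hDdef
  have hSD : S ⊆ D := fun y hy s hs hsy => hF (hsy ▸ add_mem hs hy)
  have hDfin : Dᶜ.Finite := hfin.subset (Set.compl_subset_compl.mpr hSD)
  have hDA : ∀ a ∈ A, ∀ d ∈ D, d + a ∈ D := fun a ha d hd s hs hsum =>
    hd (s + a) (hSA a ha s hs) (by omega)
  have hFD : F ∉ D := fun h => h 0 (zero_mem _) (zero_add F)
  obtain ⟨κ, hκ, hmax⟩ := h
  obtain ⟨K, hKfin, hK0, hKA, rfl⟩ := hκ.exists_eq_ofCofinite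
  have hSK : S ⊆ K := closure_subset_of_add_mem hK0 hKA
  have h1 := (YoungDiagram.ofCofinite_le_iff hfin hKfin).mp
    (hmax _ (YoungDiagram.isCore_ofCofinite hfin hSA)) 0
  have h2 := (YoungDiagram.ofCofinite_le_iff hDfin hKfin).mp
    (hmax _ (YoungDiagram.isCore_ofCofinite hDfin hDA))
  have hS0 : Nat.nth (· ∈ S) 0 = 0 := Nat.nth_zero_of_zero (zero_mem (AddSubmonoid.closure A))
  -- The gaps of `K` are among those of `S`, and comparing first columns gives at least as many of
  -- them.
  have hKS : K = S := by
    refine (compl_injective ?_).symm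
    exact (Set.eq_of_subset_of_ncard_le (Set.compl_subset_compl.mpr hSK) (by omega) hfin).symm
  subst hKS
  -- Compare the first rows.
  set j := Nat.count (· ∈ S) (F + 1) with hj
  have hnth : Nat.nth (· ∈ S) j = F + 1 :=
    Nat.nth_count (p := (· ∈ S)) (hgt _ (Nat.lt_succ_self F))
  have hjS : j + Sᶜ.ncard = F + 1 := count_add_ncard_compl fun m hm => hgt m hm
  have hjD := h2 j
  -- Column `j` of the diagram of `S` is empty, so that of `D` is too; as `F` is a gap of `D`, the
  -- `j`-th element of `D` lies beyond `F`.
  have hlt : F < Nat.nth (· ∈ D) j := by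
    set k := Nat.count (· ∈ D) (F + 1) with hk
    have hmono := nth_strictMono_of_finite_compl hDfin
    have hnthD : Nat.nth (· ∈ D) k = F + 1 :=
      Nat.nth_count (p := (· ∈ D)) (hSD (hgt _ (Nat.lt_succ_self F)))
    have hkD : k + Dᶜ.ncard = F + 1 := count_add_ncard_compl fun m hm => hSD (hgt m hm)
    by_contra! hle
    have hjk : j < k := hmono.lt_iff_lt.mp (by omega)
    obtain ⟨l, hl⟩ := Nat.exists_eq_add_of_lt hjk
    have h3 := hmono.add_le_nat l j
    have h4 := hmono (show l + j < k by omega)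
    have h5 : Nat.nth (· ∈ D) (l + j) = F := by omega
    exact hFD (h5 ▸ nth_mem_of_finite_compl hDfin (l + j))
  have hjD' := nth_eq_add_ncard_compl hDfin (j := j) fun m hm => hSD (hgt m (by omega))
  have hSDc : Dᶜ = Sᶜ :=
    Set.eq_of_subset_of_ncard_le (Set.compl_subset_compl.mpr hSD) (by omega) hfin
  have hnD : n ∉ D := by
    rw [compl_injective hSDc]
    exact hn
  simp only [hDdef, Set.mem_ofPred_eq, not_forall, not_not] at hnD
  obtain ⟨s, hs, h⟩ := hnD
  exact ⟨s, hs, h⟩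

theorem isUM_triple_of_mem {a b c : ℕ} (ha : 0 < a) (hcop_ab : Nat.Coprime a b)
    (hc : c ∈ AddSubmonoid.closure {a, b}) : IsUM {a, b, c} := by
  have hfin : ((AddSubmonoid.closure {a, b} : Set ℕ)ᶜ).Finite :=
    finite_compl_closure_of_coprime (by simp) (by simp) hcop_ab
  refine ⟨YoungDiagram.ofCofinite _ hfin, YoungDiagram.isCore_ofCofinite hfin ?_, ?_⟩
  · rintro x (rfl | rfl | rfl) d hd
    · exact add_mem hd (AddSubmonoid.subset_closure (by simp))
    · exact add_mem hd (AddSubmonoid.subset_closure (by simp))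
    · exact add_mem hd hc
  · intro μ hμ
    obtain ⟨D, hD, h0, hDA, rfl⟩ := hμ.exists_eq_ofCofinite
    exact YoungDiagram.ofCofinite_le_ofCofinite_closure_pair ha hcop_ab hD h0
      (hDA a (by simp)) (hDA b (by simp)) hfin

theorem corollary1p4 (a b c : ℕ) (ha : 0 < a) (hab : a < b) (hbc : b < c)
    (hcop_ab : Nat.Coprime a b) (hcop_ac : Nat.Coprime a c) (hcop_bc : Nat.Coprime b c) :
    IsUM {a, b, c} ↔ c ∈ numericalSemigroup {a, b} := by
  refine ⟨fun h => ?_, isUM_triple_of_mem ha hcop_ab⟩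
  by_contra hc
  have hc' : ∀ x y, c ≠ x * a + y * b := fun x y hxy =>
    hc ((AddSubmonoid.mem_closure_pair _ _ _).mpr ⟨x, y, hxy.symm⟩)
  have hfin : ((AddSubmonoid.closure {a, b, c} : Set ℕ)ᶜ).Finite :=
    finite_compl_closure_of_coprime (a := a) (b := b) (by simp) (by simp) hcop_ab
  -- This provides a gap, so that a largest one exists; `a = 1` would put `c` in `S(a,b)`.
  have hone : 1 ∉ AddSubmonoid.closure {a, b, c} := by
    intro h1
    obtain ⟨x, y, z, hxyz⟩ := mem_closure_triple_iff.mp h1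
    have ha1 : a ≠ 1 := by
      rintro rfl
      exact hc' c 0 (by ring)
    rcases Nat.eq_zero_or_pos x with rfl | hx
    · rcases Nat.eq_zero_or_pos y with rfl | hy
      · rcases Nat.eq_zero_or_pos z with rfl | hz
        · omega
        · have := Nat.le_mul_of_pos_left c hz
          omega
      · have := Nat.le_mul_of_pos_left b hy
        omega
    · have := Nat.le_mul_of_pos_left a hx
      omega
  obtain ⟨F, hF, hmax⟩ := Set.exists_max_image _ id hfin ⟨1, hone⟩
  have hgt : ∀ n > F, n ∈ AddSubmonoid.closure {a, b, c} := by
    intro n hn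
    by_contra h'
    exact absurd (hmax n h') (by simpa using hn)
  exact not_symmetric_closure_triple ha hab hbc hcop_ab hcop_ac hcop_bc hc' hF hgt
    fun n hn => h.symmetric hfin hF hgt hn
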